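/- Let $1\le k<d$ be integers, let $\phi$ be a probability measure on $\mathbb{R}^d$ that is even ($\phi(-A)=\phi(A)$ for every Borel set $A$) and assigns measure zero to every hyperplane through the origin, and let $X_1,X_2,\dots$ be independent random vectors with distribution $\phi$. For $N>d$, the Cover–Efron cone $C_N$ is the random cone $\operatorname{pos}\{X_1,\dots,X_N\}$ (the positive hull) under the condition that this positive hull is different from $\mathbb{R}^d$. Let $f_k(C)$ denote the number of $k$-dimensional faces of a polyhedral convex cone $C$, and let $\mathbb{E}f_k(C_N)$ be the expectation of $f_k(\operatorname{pos}\{X_1,\dots,X_N\})$ under the corresponding conditional probability. Then these expectations are finite, and for every $N>d$, $$\frac{\mathbb{E} f_k(C_{N+1})}{\binom{N+1}{k}} < \frac{\mathbb{E} f_k(C_N)}{\binom{N}{k}}.$$ Consequently the quotient $\mathbb{E} f_k(C_N)/\binom{N}{k}$ is strictly decreasing in $N$ on $\{N : N>d\}$, and for every $N>d$, $$\frac{\mathbb{E} f_k(C_N)}{\binom{N}{k}} \le \frac{2^d-2^k}{2^d-1},$$ with equality if and only if $N=d+1$. -/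

import Mathlib

open MeasureTheory ProbabilityTheory

noncomputable section

/-- The `k`-dimensional faces of a convex cone `C` in `ℝ^d`; the dimension of a face is the
dimension of its linear hull. -/
def coneFaces {d : ℕ} (k : ℕ) (C : PointedCone ℝ (EuclideanSpace ℝ (Fin d))) :
    Set (PointedCone ℝ (EuclideanSpace ℝ (Fin d))) :=
  {F | F.IsFaceOf C ∧
    Module.finrank ℝ (Submodule.span ℝ (F : Set (EuclideanSpace ℝ (Fin d)))) = k}

/-- `f_k(C)`, the number of `k`-dimensional faces of `C` (finite for polyhedral cones). -/
def faceNumber {d : ℕ} (k : ℕ) (C : PointedCone ℝ (EuclideanSpace ℝ (Fin d))) : ℕ :=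
  (coneFaces k C).ncard

/-- The positive hull of the first `N` of the vectors `x 0, x 1, …`. -/
def posHull {d : ℕ} (x : ℕ → EuclideanSpace ℝ (Fin d)) (N : ℕ) :
    PointedCone ℝ (EuclideanSpace ℝ (Fin d)) :=
  PointedCone.hull ℝ (Set.range fun i : Fin N => x i)

/-- The conditional probability given that the positive hull of the first `N` random vectors is
not the whole space. Under this measure, the positive hull is the Cover-Efron cone `C_N`. -/
def coverEfronMeasure {Ω : Type*} [MeasurableSpace Ω] {d : ℕ} (P : Measure Ω)
    (X : ℕ → Ω → EuclideanSpace ℝ (Fin d)) (N : ℕ) : Measure Ω :=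
  ProbabilityTheory.cond P {ω | posHull (fun i => X i ω) N ≠ ⊤}

/-- `𝔼 f_k(C_N)`, the expected number of `k`-faces of the Cover-Efron cone `C_N`. -/
def expectedFaceNumber {Ω : Type*} [MeasurableSpace Ω] {d : ℕ} (P : Measure Ω)
    (X : ℕ → Ω → EuclideanSpace ℝ (Fin d)) (k N : ℕ) : ℝ :=
  ∫ ω, (faceNumber k (posHull (fun i => X i ω) N) : ℝ) ∂(coverEfronMeasure P X N)

end

section Flip

variable {ι : Type*}

/-- The family obtained by reversing the sign of `x b`. -/
def flipAt [DecidableEq ι] (b : ι) {E : Type*} [AddCommGroup E] (x : ι → E) : ι → E :=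
  fun i => if i = b then -x i else x i

lemma flipAt_same [DecidableEq ι] (b : ι) {E : Type*} [AddCommGroup E] (x : ι → E) :
    flipAt b x b = -x b := by simp [flipAt]

lemma flipAt_of_ne [DecidableEq ι] {b i : ι} (h : i ≠ b) {E : Type*} [AddCommGroup E]
    (x : ι → E) : flipAt b x i = x i := by simp [flipAt, h]

end Flip

section Separation

variable {ι E : Type*} [NormedAddCommGroup E] [InnerProductSpace ℝ E]

/-- Some vector is orthogonal to all `x a`, `a ∈ A`, and has positive inner product with all
`x b`, `b ∈ B`. -/
def Separates (x : ι → E) (A B : Finset ι) : Prop :=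
  ∃ u : E, (∀ a ∈ A, inner ℝ u (x a) = 0) ∧ ∀ b ∈ B, 0 < inner ℝ u (x b)

/-- Every subfamily of size at most `dim E` is linearly independent. -/
def InGeneralPosition (x : ι → E) : Prop :=
  ∀ s : Finset ι, s.card ≤ Module.finrank ℝ E → LinearIndepOn ℝ x (s : Set ι)

lemma separates_empty_right (x : ι → E) (A : Finset ι) : Separates x A ∅ :=
  ⟨0, by simp, by simp⟩

lemma exists_pos_forall_inner_add_smul_pos (x : ι → E) (B : Finset ι) (u v : E)
    (hu : ∀ b ∈ B, 0 < inner ℝ u (x b)) :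
    ∃ δ : ℝ, 0 < δ ∧ ∀ b ∈ B, 0 < inner ℝ (u + δ • v) (x b) := by
  have h : ∀ᶠ δ in nhdsWithin (0 : ℝ) (Set.Ioi 0), ∀ b ∈ B, 0 < inner ℝ (u + δ • v) (x b) := by
    rw [Filter.eventually_all_finset]
    intro b hb
    have hc : Filter.Tendsto (fun δ : ℝ => (inner ℝ (u + δ • v) (x b) : ℝ)) (nhds 0)
        (nhds (inner ℝ (u + (0 : ℝ) • v) (x b))) := by
      apply Continuous.tendsto
      fun_prop
    refine (hc.eventually_const_lt ?_).filter_mono nhdsWithin_le_nhds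
    simpa using hu b hb
  obtain ⟨δ, h1, h2⟩ := (h.and self_mem_nhdsWithin).exists
  exact ⟨δ, h2, h1⟩

/-- Vectors with prescribed inner products against a linearly independent family. -/
lemma LinearIndepOn.exists_inner_eq [FiniteDimensional ℝ E] {x : ι → E} {s : Finset ι}
    (hs : LinearIndepOn ℝ x (s : Set ι)) (c : ι → ℝ) :
    ∃ v : E, ∀ i ∈ s, inner ℝ v (x i) = c i := by
  have := hs.linearIndependent
  let b := Module.Basis.span this
  obtain ⟨f, hf⟩ := LinearMap.exists_extend (b.constr ℝ (fun i : (s : Set ι) => c i))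
  refine ⟨(InnerProductSpace.toDual ℝ E).symm (LinearMap.toContinuousLinearMap f), fun i hi => ?_⟩
  rw [InnerProductSpace.toDual_symm_apply]
  have h1 := congrArg (fun g => g (b ⟨i, hi⟩)) hf
  simp only [LinearMap.comp_apply, Module.Basis.constr_basis, Submodule.subtype_apply] at h1
  rw [← h1]
  simp [b, Module.Basis.span_apply]

lemma not_separates_of_card_eq [FiniteDimensional ℝ E] {x : ι → E}
    (hx : InGeneralPosition x) {A B : Finset ι}
    (hA : A.card = Module.finrank ℝ E) (hB : B.Nonempty) : ¬ Separates x A B := by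
  rintro ⟨u, hu, hb⟩
  obtain ⟨b, hbB⟩ := hB
  have hli := (hx A hA.le).linearIndependent
  have htop : Submodule.span ℝ (Set.range fun a : (A : Set ι) => x a) = ⊤ :=
    hli.span_eq_top_of_card_eq_finrank' (by simp [hA])
  have hle : Submodule.span ℝ (Set.range fun a : (A : Set ι) => x a) ≤
      LinearMap.ker (innerₛₗ ℝ u) := by
    rw [Submodule.span_le]
    rintro _ ⟨a, rfl⟩
    simpa using hu a a.2
  have : x b ∈ LinearMap.ker (innerₛₗ ℝ u) := hle (htop ▸ Submodule.mem_top)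
  have h2 := hb b hbB
  simp at this
  linarith

variable [DecidableEq ι]

lemma separates_flipAt_insert {x : ι → E} {A B : Finset ι} {b : ι} (hbA : b ∉ A) (hbB : b ∉ B) :
    Separates (flipAt b x) A (insert b B) ↔
      ∃ u : E, (∀ a ∈ A, inner ℝ u (x a) = 0) ∧ (∀ i ∈ B, 0 < inner ℝ u (x i)) ∧
        inner ℝ u (x b) < 0 := by
  unfold Separates
  refine exists_congr fun u => ?_
  rw [Finset.forall_mem_insert, flipAt_same, inner_neg_right, neg_pos]
  have h1 : ∀ a ∈ A, flipAt b x a = x a := fun a ha => flipAt_of_ne (by grind) x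
  have h2 : ∀ a ∈ B, flipAt b x a = x a := fun a ha => flipAt_of_ne (by grind) x
  constructor
  · rintro ⟨h, h', h''⟩
    exact ⟨fun a ha => h1 a ha ▸ h a ha, fun a ha => h2 a ha ▸ h'' a ha, h'⟩
  · rintro ⟨h, h', h''⟩
    exact ⟨fun a ha => (h1 a ha).symm ▸ h a ha, h'', fun a ha => (h2 a ha).symm ▸ h' a ha⟩

lemma exists_orthogonal_inner_eq_one [FiniteDimensional ℝ E] {x : ι → E}
    (hx : InGeneralPosition x) {A : Finset ι} {b : ι}
    (hbA : b ∉ A) (hA : A.card < Module.finrank ℝ E) :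
    ∃ v : E, (∀ a ∈ A, inner ℝ v (x a) = 0) ∧ inner ℝ v (x b) = 1 := by
  obtain ⟨v, hv⟩ := LinearIndepOn.exists_inner_eq
    (hx (insert b A) (by rw [Finset.card_insert_of_notMem hbA]; omega))
    (fun i => if i = b then 1 else 0)
  refine ⟨v, fun a ha => ?_, ?_⟩
  · rw [hv a (Finset.mem_insert_of_mem ha), if_neg (by grind)]
  · rw [hv b (Finset.mem_insert_self _ _), if_pos rfl]

lemma separates_or_flipAt_iff [FiniteDimensional ℝ E] {x : ι → E}
    (hx : InGeneralPosition x) {A B : Finset ι} {b : ι}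
    (hbA : b ∉ A) (hbB : b ∉ B) (hA : A.card < Module.finrank ℝ E) :
    Separates x A (insert b B) ∨ Separates (flipAt b x) A (insert b B) ↔ Separates x A B := by
  rw [separates_flipAt_insert hbA hbB]
  constructor
  · rintro (⟨u, h1, h2⟩ | ⟨u, h1, h2, -⟩)
    · exact ⟨u, h1, fun i hi => h2 i (Finset.mem_insert_of_mem hi)⟩
    · exact ⟨u, h1, h2⟩
  · rintro ⟨u, h1, h2⟩
    rcases lt_trichotomy (inner ℝ u (x b)) 0 with h | h | h
    · exact Or.inr ⟨u, h1, h2, h⟩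
    · obtain ⟨v, hv1, hv2⟩ := exists_orthogonal_inner_eq_one hx hbA hA
      obtain ⟨δ, hδ, hB⟩ := exists_pos_forall_inner_add_smul_pos x B u v h2
      refine Or.inl ⟨u + δ • v, fun a ha => ?_, fun i hi => ?_⟩
      · simp [inner_add_left, inner_smul_left, h1 a ha, hv1 a ha]
      · rcases Finset.mem_insert.1 hi with rfl | hi
        · simpa [inner_add_left, inner_smul_left, h, hv2] using hδ
        · exact hB i hi
    · exact Or.inl ⟨u, h1, by simpa using ⟨h, h2⟩⟩

lemma separates_and_flipAt_iff [FiniteDimensional ℝ E] {x : ι → E}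
    (hx : InGeneralPosition x) {A B : Finset ι} {b : ι}
    (hbA : b ∉ A) (hbB : b ∉ B) (hA : A.card < Module.finrank ℝ E) :
    Separates x A (insert b B) ∧ Separates (flipAt b x) A (insert b B) ↔
      Separates x (insert b A) B := by
  rw [separates_flipAt_insert hbA hbB]
  constructor
  · rintro ⟨⟨u, h1, h2⟩, ⟨v, h3, h4, h5⟩⟩
    have hb := h2 b (Finset.mem_insert_self _ _)
    refine ⟨(-inner ℝ v (x b)) • u + (inner ℝ u (x b)) • v, fun a ha => ?_, fun i hi => ?_⟩
    · rcases Finset.mem_insert.1 ha with rfl | ha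
      · simp [inner_add_left, inner_smul_left]; ring
      · simp [inner_add_left, inner_smul_left, h1 a ha, h3 a ha]
    · have e1 := mul_pos (neg_pos.2 h5) (h2 i (Finset.mem_insert_of_mem hi))
      have e2 := mul_pos hb (h4 i hi)
      rw [inner_add_left, real_inner_smul_left, real_inner_smul_left]
      linarith
  · rintro ⟨u, h1, h2⟩
    obtain ⟨v, hv1, hv2⟩ := exists_orthogonal_inner_eq_one hx hbA hA
    have h0 := h1 b (Finset.mem_insert_self _ _)
    constructor
    · obtain ⟨δ, hδ, hB⟩ := exists_pos_forall_inner_add_smul_pos x B u v h2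
      refine ⟨u + δ • v, fun a ha => ?_, fun i hi => ?_⟩
      · simp [inner_add_left, inner_smul_left, h1 a (Finset.mem_insert_of_mem ha), hv1 a ha]
      · rcases Finset.mem_insert.1 hi with rfl | hi
        · simpa [inner_add_left, inner_smul_left, h0, hv2] using hδ
        · exact hB i hi
    · obtain ⟨δ, hδ, hB⟩ := exists_pos_forall_inner_add_smul_pos x B u (-v) h2
      refine ⟨u + δ • (-v), fun a ha => ?_, hB, ?_⟩
      · simp [inner_add_left, inner_smul_left, h1 a (Finset.mem_insert_of_mem ha), hv1 a ha]
      · simpa [inner_add_left, inner_smul_left, h0, hv2] using hδ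

/-- In general position, weak separation by a nonzero vector can be made strict. -/
lemma separates_of_nonneg [FiniteDimensional ℝ E] [Fintype ι] {x : ι → E}
    (hx : InGeneralPosition x) {A : Finset ι} {u : E}
    (hu : u ≠ 0) (hA : ∀ a ∈ A, inner ℝ u (x a) = 0) (h : ∀ i, 0 ≤ inner ℝ u (x i)) :
    Separates x A Aᶜ := by
  classical
  set J : Finset ι := Finset.univ.filter fun i => inner ℝ u (x i) = 0 with hJ
  have hJc : J.card ≤ Module.finrank ℝ E := by
    by_contra! hlt
    obtain ⟨T, hTJ, hT⟩ := Finset.exists_subset_card_eq hlt.le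
    have hli := (hx T hT.le).linearIndependent
    have htop : Submodule.span ℝ (Set.range fun a : (T : Set ι) => x a) = ⊤ :=
      hli.span_eq_top_of_card_eq_finrank' (by simp [hT])
    have hle : Submodule.span ℝ (Set.range fun a : (T : Set ι) => x a) ≤
        LinearMap.ker (innerₛₗ ℝ u) := by
      rw [Submodule.span_le]
      rintro _ ⟨a, rfl⟩
      simpa [hJ] using hTJ a.2
    have : u ∈ LinearMap.ker (innerₛₗ ℝ u) := hle (htop ▸ Submodule.mem_top)
    simp at this
    exact hu this
  obtain ⟨v, hv⟩ := (hx J hJc).exists_inner_eq (fun i => if i ∈ A then 0 else 1)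
  obtain ⟨δ, hδ, hB⟩ := exists_pos_forall_inner_add_smul_pos x Jᶜ u v (by
    intro b hb
    exact lt_of_le_of_ne (h b) (fun h => by simp [hJ, ← h] at hb))
  refine ⟨u + δ • v, fun a ha => ?_, fun i hi => ?_⟩
  · have := hv a (by simp [hJ, hA a ha])
    rw [if_pos ha] at this
    simp [inner_add_left, inner_smul_left, hA a ha, this]
  · by_cases hiJ : i ∈ J
    · have := hv i hiJ
      rw [if_neg (by simpa using hi)] at this
      rw [inner_add_left, real_inner_smul_left, this]
      have := h i
      linarith
    · exact hB i (by simpa using hiJ)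

end Separation

lemma separates_iff_exists_one_le {ι E : Type*} [NormedAddCommGroup E] [InnerProductSpace ℝ E]
    {x : ι → E} {A B : Finset ι} :
    Separates x A B ↔
      ∃ u : E, (∀ a ∈ A, inner ℝ u (x a) = 0) ∧ ∀ b ∈ B, 1 ≤ inner ℝ u (x b) := by
  constructor
  · rintro ⟨u, hA, hB⟩
    rcases B.eq_empty_or_nonempty with rfl | hne
    · exact ⟨u, hA, by simp⟩
    obtain ⟨b₀, hb₀, hmin⟩ := B.exists_min_image (fun b => inner ℝ u (x b)) hne
    have h0 := hB b₀ hb₀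
    refine ⟨(inner ℝ u (x b₀))⁻¹ • u, fun a ha => ?_, fun b hb => ?_⟩
    · simp [inner_smul_left, hA a ha]
    · rw [real_inner_smul_left, ← inv_mul_cancel₀ h0.ne']
      exact mul_le_mul_of_nonneg_left (hmin b hb) (inv_nonneg.2 h0.le)
  · rintro ⟨u, hA, hB⟩
    exact ⟨u, hA, fun b hb => lt_of_lt_of_le one_pos (hB b hb)⟩

section Measurability

variable {ι E : Type*} [Fintype ι] [NormedAddCommGroup E] [InnerProductSpace ℝ E]
  [FiniteDimensional ℝ E] [MeasurableSpace E] [BorelSpace E]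

lemma IsSigmaCompact.measurableSet {X : Type*} [TopologicalSpace X] [T2Space X]
    [MeasurableSpace X] [OpensMeasurableSpace X] {s : Set X} (hs : IsSigmaCompact s) :
    MeasurableSet s := by
  obtain ⟨K, hK, rfl⟩ := hs
  exact MeasurableSet.iUnion fun n => (hK n).isClosed.measurableSet

lemma IsClosed.measurableSet_image {X Y : Type*} [TopologicalSpace X] [SigmaCompactSpace X]
    [TopologicalSpace Y] [T2Space Y] [MeasurableSpace Y] [OpensMeasurableSpace Y] {f : X → Y}
    (hf : Continuous f) {s : Set X} (hs : IsClosed s) : MeasurableSet (f '' s) :=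
  ((isSigmaCompact_univ.of_isClosed_subset hs (Set.subset_univ s)).image hf).measurableSet

lemma measurableSet_separates (A B : Finset ι) :
    MeasurableSet {x : ι → E | Separates x A B} := by
  have hcl : IsClosed {p : (ι → E) × E | (∀ a ∈ A, inner ℝ p.2 (p.1 a) = 0) ∧
      ∀ b ∈ B, 1 ≤ inner ℝ p.2 (p.1 b)} := by
    simp only [Set.ofPred_and, Set.ofPred_forall]
    refine IsClosed.inter ?_ ?_
    · exact isClosed_biInter fun a _ => isClosed_eq (by fun_prop) continuous_const
    · exact isClosed_biInter fun a _ => isClosed_le continuous_const (by fun_prop)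
  convert! hcl.measurableSet_image continuous_fst
  ext x
  simp [separates_iff_exists_one_le]

lemma measurableSet_mem_span (i : ι) (s : Finset ι) :
    MeasurableSet {x : ι → E | x i ∈ Submodule.span ℝ (x '' s)} := by
  have hcl : IsClosed {p : (ι → E) × (ι → ℝ) | ∑ j ∈ s, p.2 j • p.1 j = p.1 i} :=
    isClosed_eq (by fun_prop) (by fun_prop)
  convert! hcl.measurableSet_image continuous_fst
  ext x
  simp only [Set.mem_ofPred_eq, Set.mem_image, Prod.exists, exists_and_right, exists_eq_right]
  exact Submodule.mem_span_image_finset_iff_exists_fun' ℝ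

end Measurability

lemma measure_submodule_eq_zero {E : Type*} [NormedAddCommGroup E]
    [InnerProductSpace ℝ E] [FiniteDimensional ℝ E] [MeasurableSpace E] {φ : Measure E}
    (hφ : ∀ u : E, u ≠ 0 → φ {x | inner ℝ u x = 0} = 0) {W : Submodule ℝ E} (hW : W ≠ ⊤) :
    φ (W : Set E) = 0 := by
  obtain ⟨u, hu, hu0⟩ := Submodule.exists_mem_ne_zero_of_ne_bot
    (mt (Submodule.orthogonal_eq_bot_iff (K := W)).1 hW)
  refine measure_mono_null (fun x hx => ?_) (hφ u hu0)
  exact (Submodule.mem_orthogonal' W u).1 hu x hx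

section GeneralPosition

variable {ι E : Type*} [Fintype ι] [NormedAddCommGroup E] [InnerProductSpace ℝ E]
  [FiniteDimensional ℝ E] [MeasurableSpace E] [BorelSpace E]

lemma measure_mem_span_eq_zero {φ : Measure E} [IsProbabilityMeasure φ]
    (hφ : ∀ u : E, u ≠ 0 → φ {x | inner ℝ u x = 0} = 0) {i : ι} {s : Finset ι} (hi : i ∉ s)
    (hs : s.card < Module.finrank ℝ E) :
    Measure.pi (fun _ : ι => φ) {x | x i ∈ Submodule.span ℝ (x '' s)} = 0 := by
  classical
  have hm := measurableSet_mem_span (E := E) i s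
  rw [← lintegral_indicator_one hm, lintegral_eq_lmarginal_univ 0,
    ← Finset.insert_erase (Finset.mem_univ i),
    lmarginal_insert' (hf := measurable_one.indicator hm) (hi := Finset.notMem_erase _ _)]
  have : ∀ x : ι → E, ∫⁻ v, ({x : ι → E | x i ∈ Submodule.span ℝ (x '' s)}.indicator 1
      (Function.update x i v) : ENNReal) ∂φ = 0 := by
    intro x
    have hW : Submodule.span ℝ (x '' s) ≠ ⊤ := by
      intro h
      have h1 := finrank_span_finset_le_card (R := ℝ) (s.image x)
      rw [Finset.coe_image, Set.finrank, h, finrank_top] at h1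
      have := s.card_image_le (f := x)
      omega
    have e : ∀ v, ({x : ι → E | x i ∈ Submodule.span ℝ (x '' s)}.indicator 1
        (Function.update x i v) : ENNReal) =
        (Submodule.span ℝ (x '' s) : Set E).indicator 1 v := by
      intro v
      have : Function.update x i v '' s = x '' s := Set.image_congr fun j hj =>
        Function.update_of_ne (by rintro rfl; exact hi hj) _ _
      simp [Set.indicator, this]
    simp_rw [e]
    rw [lintegral_indicator_one (Submodule.closed_of_finiteDimensional _).measurableSet]
    exact measure_submodule_eq_zero hφ hW
  simp_rw [this]
  simp [lmarginal]

lemma ae_inGeneralPosition {φ : Measure E} [IsProbabilityMeasure φ]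
    (hφ : ∀ u : E, u ≠ 0 → φ {x | inner ℝ u x = 0} = 0) :
    ∀ᵐ x ∂Measure.pi (fun _ : ι => φ), InGeneralPosition x := by
  classical
  unfold InGeneralPosition
  rw [ae_all_iff]
  intro s
  induction s using Finset.induction_on with
  | empty => simp
  | insert i s hi ih =>
    by_cases hc : (insert i s).card ≤ Module.finrank ℝ E
    · rw [Finset.card_insert_of_notMem hi] at hc
      have h0 : ∀ᵐ x ∂Measure.pi (fun _ : ι => φ), x i ∉ Submodule.span ℝ (x '' s) := by
        rw [ae_iff]
        simpa using measure_mem_span_eq_zero hφ hi (by omega)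
      filter_upwards [ih, h0] with x h1 h2 _
      rw [Finset.coe_insert, linearIndepOn_insert (by simpa using hi)]
      exact ⟨h1 (by omega), h2⟩
    · simp [hc]

end GeneralPosition

/-- The number of regions cut out by `n` hyperplanes through the origin in general position in
an `m`-dimensional space. -/
def coverCount : ℕ → ℕ → ℕ
  | 0, _ => 1
  | _ + 1, 0 => 0
  | n + 1, m + 1 => coverCount n (m + 1) + coverCount n m

section Probability

variable {ι E : Type*} [Fintype ι] [NormedAddCommGroup E] [InnerProductSpace ℝ E]
  [FiniteDimensional ℝ E] [MeasurableSpace E] [BorelSpace E]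

lemma measurePreserving_flipAt [DecidableEq ι] {φ : Measure E} [IsProbabilityMeasure φ]
    (hφ : φ.map (fun x => -x) = φ) (b : ι) :
    MeasurePreserving (flipAt b) (Measure.pi fun _ : ι => φ) (Measure.pi fun _ : ι => φ) := by
  refine measurePreserving_pi (fun _ : ι => φ) (fun _ : ι => φ)
    (f := fun i x => if i = b then -x else x) fun i => ?_
  by_cases h : i = b
  · simpa [h] using ⟨measurable_neg, hφ⟩
  · simpa only [h, if_false] using! MeasurePreserving.id φ

theorem measure_separates {φ : Measure E} [IsProbabilityMeasure φ]
    (hφ_even : φ.map (fun x => -x) = φ)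
    (hφ : ∀ u : E, u ≠ 0 → φ {x | inner ℝ u x = 0} = 0) (B : Finset ι) :
    ∀ A : Finset ι, Disjoint A B → A.card ≤ Module.finrank ℝ E →
      (Measure.pi fun _ : ι => φ).real {x | Separates x A B} =
        coverCount B.card (Module.finrank ℝ E - A.card) / 2 ^ B.card := by
  classical
  set μ := Measure.pi fun _ : ι => φ
  have hgp : ∀ᵐ x ∂μ, InGeneralPosition x := ae_inGeneralPosition hφ
  induction B using Finset.induction_on with
  | empty =>
    intro A _ _
    simp [separates_empty_right, coverCount]
  | insert b B hb ih =>
    intro A hAB hA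
    have hbA : b ∉ A := fun h => Finset.disjoint_left.1 hAB h (Finset.mem_insert_self _ _)
    have hd : Disjoint A B := hAB.mono_right (Finset.subset_insert _ _)
    rcases hA.eq_or_lt with hA | hA
    · have : μ {x | Separates x A (insert b B)} = 0 := by
        rw [measure_eq_zero_iff_ae_notMem]
        filter_upwards [hgp] with x hx
        exact not_separates_of_card_eq hx hA (Finset.insert_nonempty _ _)
      simp [Measure.real, this, hA, hb, coverCount]
    · obtain ⟨m, hm⟩ : ∃ m, Module.finrank ℝ E - A.card = m + 1 :=
        ⟨Module.finrank ℝ E - A.card - 1, by omega⟩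
      have hflip : μ.real {x | Separates (flipAt b x) A (insert b B)} =
          μ.real {x | Separates x A (insert b B)} :=
        (measurePreserving_flipAt hφ_even b).measureReal_preimage
          (measurableSet_separates A (insert b B)).nullMeasurableSet
      have hmeas : MeasurableSet {x : ι → E | Separates (flipAt b x) A (insert b B)} :=
        (measurePreserving_flipAt hφ_even b).measurable (measurableSet_separates A (insert b B))
      have key := measureReal_union_add_inter (μ := μ) (s := {x | Separates x A (insert b B)}) hmeas
      have hor : μ.real ({x | Separates x A (insert b B)} ∪
          {x | Separates (flipAt b x) A (insert b B)}) = μ.real {x | Separates x A B} := by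
        refine measureReal_congr ?_
        filter_upwards [hgp] with x hx
        exact propext (separates_or_flipAt_iff hx hbA hb hA)
      have hand : μ.real ({x | Separates x A (insert b B)} ∩
          {x | Separates (flipAt b x) A (insert b B)}) =
            μ.real {x | Separates x (insert b A) B} := by
        refine measureReal_congr ?_
        filter_upwards [hgp] with x hx
        exact propext (separates_and_flipAt_iff hx hbA hb hA)
      have h1 := ih A hd hA.le
      have h2 := ih (insert b A) (Finset.disjoint_insert_left.2 ⟨hb, hd⟩)
        (by rw [Finset.card_insert_of_notMem hbA]; omega)
      rw [Finset.card_insert_of_notMem hbA,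
        show Module.finrank ℝ E - (A.card + 1) = m by omega] at h2
      rw [hor, hand, hflip, h1, h2, hm] at key
      rw [Finset.card_insert_of_notMem hb, hm, coverCount, pow_succ]
      push_cast
      field_simp at key ⊢
      linarith

end Probability

section Cones

variable {ι E : Type*} [NormedAddCommGroup E] [InnerProductSpace ℝ E]

lemma PointedCone.span_hull (s : Set E) :
    Submodule.span ℝ (PointedCone.hull ℝ s : Set E) = Submodule.span ℝ s :=
  Submodule.span_span_of_tower _ _ s

lemma LinearIndepOn.finrank_span_image {x : ι → E} {I : Finset ι}
    (h : LinearIndepOn ℝ x (I : Set ι)) : Module.finrank ℝ (Submodule.span ℝ (x '' I)) = I.card := by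
  rw [Set.image_eq_range]
  simpa using finrank_span_eq_card h.linearIndependent

variable [Fintype ι]

lemma PointedCone.mem_hull_range_iff {x : ι → E} {y : E} :
    y ∈ PointedCone.hull ℝ (Set.range x) ↔ ∃ c : ι → ℝ, (∀ i, 0 ≤ c i) ∧ ∑ i, c i • x i = y := by
  rw [PointedCone.hull, Submodule.mem_span_range_iff_exists_fun]
  constructor
  · rintro ⟨c, rfl⟩
    exact ⟨fun i => c i, fun i => (c i).2, rfl⟩
  · rintro ⟨c, hc, rfl⟩
    exact ⟨fun i => ⟨c i, hc i⟩, rfl⟩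

lemma PointedCone.inner_nonneg_of_mem_hull_range {x : ι → E} {u y : E}
    (hu : ∀ i, 0 ≤ inner ℝ u (x i)) (hy : y ∈ PointedCone.hull ℝ (Set.range x)) :
    0 ≤ inner ℝ u y := by
  obtain ⟨c, hc, rfl⟩ := mem_hull_range_iff.1 hy
  rw [inner_sum]
  exact Finset.sum_nonneg fun i _ => by
    rw [real_inner_smul_right]; exact mul_nonneg (hc i) (hu i)

lemma PointedCone.mem_hull_image_of_sum {x : ι → E} {I : Finset ι} {c : ι → ℝ}
    (hc : ∀ i, 0 ≤ c i) (h : ∀ i ∉ I, c i = 0) :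
    ∑ i, c i • x i ∈ PointedCone.hull ℝ (x '' I) := by
  refine Submodule.sum_mem _ fun i _ => ?_
  by_cases hi : i ∈ I
  · exact PointedCone.smul_mem _ (hc i) (PointedCone.subset_hull ⟨i, hi, rfl⟩)
  · simp [h i hi]

lemma PointedCone.mem_hull_image_of_inner_eq_zero {x : ι → E} {I : Finset ι} {u y : E}
    (hI : ∀ i ∈ I, inner ℝ u (x i) = 0) (hIc : ∀ i ∉ I, 0 < inner ℝ u (x i))
    (hy : y ∈ PointedCone.hull ℝ (Set.range x)) (h0 : inner ℝ u y = 0) :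
    y ∈ PointedCone.hull ℝ (x '' I) := by
  obtain ⟨c, hc, rfl⟩ := mem_hull_range_iff.1 hy
  refine mem_hull_image_of_sum hc fun i hi => ?_
  rw [inner_sum, Finset.sum_eq_zero_iff_of_nonneg] at h0
  · have := h0 i (Finset.mem_univ i)
    rw [real_inner_smul_right] at this
    exact (mul_eq_zero.1 this).resolve_right (hIc i hi).ne'
  · intro j _
    rw [real_inner_smul_right]
    refine mul_nonneg (hc j) ?_
    by_cases hj : j ∈ I
    · exact (hI j hj).ge
    · exact (hIc j hj).le

lemma PointedCone.isFaceOf_hull_image {x : ι → E} {I : Finset ι} {u : E}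
    (hI : ∀ i ∈ I, inner ℝ u (x i) = 0) (hIc : ∀ i ∉ I, 0 < inner ℝ u (x i)) :
    (PointedCone.hull ℝ (x '' I)).IsFaceOf (PointedCone.hull ℝ (Set.range x)) := by
  have hle : PointedCone.hull ℝ (x '' I) ≤ PointedCone.hull ℝ (Set.range x) :=
    Submodule.span_mono (Set.image_subset_range x I)
  have hu : ∀ i, 0 ≤ inner ℝ u (x i) := fun i => by
    by_cases hi : i ∈ I
    · exact (hI i hi).ge
    · exact (hIc i hi).le
  have hzero : ∀ y ∈ PointedCone.hull ℝ (x '' I), inner ℝ u y = 0 := by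
    intro y hy
    induction hy using Submodule.span_induction with
    | mem y h => obtain ⟨i, hi, rfl⟩ := h; exact hI i hi
    | zero => simp
    | add y z _ _ h1 h2 => rw [inner_add_right, h1, h2, add_zero]
    | smul a y _ h => change inner ℝ u ((a : ℝ) • y) = 0; rw [real_inner_smul_right, h, mul_zero]
  refine ⟨hle, fun {y z a} hy hz ha h => ?_⟩
  refine mem_hull_image_of_inner_eq_zero hI hIc hy ?_
  have h0 := hzero _ h
  rw [inner_add_right, real_inner_smul_right] at h0
  have h1 := inner_nonneg_of_mem_hull_range hu hy
  have h2 := inner_nonneg_of_mem_hull_range hu hz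
  have h3 := mul_nonneg ha.le h1
  exact (mul_eq_zero.1 (le_antisymm (by linarith) h3)).resolve_left ha.ne'

lemma PointedCone.IsFaceOf.eq_hull_image {x : ι → E} {F : PointedCone ℝ E}
    (hF : F.IsFaceOf (PointedCone.hull ℝ (Set.range x))) {I : Finset ι}
    (hI : ∀ i, i ∈ I ↔ x i ∈ F) : F = PointedCone.hull ℝ (x '' I) := by
  refine le_antisymm (fun y hy => ?_) ?_
  · obtain ⟨c, hc, rfl⟩ := mem_hull_range_iff.1 (hF.le hy)
    refine mem_hull_image_of_sum hc fun i hi => ?_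
    by_contra h
    exact hi ((hI i).2 (hF.mem_of_sum_smul_mem
      (fun j => PointedCone.subset_hull (Set.mem_range_self j)) hc hy i
      (lt_of_le_of_ne (hc i) (Ne.symm h))))
  · rw [PointedCone.hull, Submodule.span_le]
    rintro _ ⟨i, hi, rfl⟩
    exact (hI i).1 hi

/-- A full-dimensional proper cone lies in a half-space. -/
lemma PointedCone.exists_inner_nonneg [FiniteDimensional ℝ E] {D : PointedCone ℝ E}
    (hspan : Submodule.span ℝ (D : Set E) = ⊤) (hD : D ≠ ⊤) :
    ∃ u : E, u ≠ 0 ∧ ∀ y ∈ D, 0 ≤ inner ℝ u y := by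
  obtain ⟨p, hp⟩ : ∃ p, p ∉ D := by
    by_contra! h
    exact hD (top_unique fun y _ => h y)
  have hint : (interior (D : Set E)).Nonempty := by
    rw [D.convex.interior_nonempty_iff_affineSpan_eq_top, AffineSubspace.ext_iff,
      ← Set.insert_eq_of_mem (show (0 : E) ∈ (D : Set E) from D.zero_mem), affineSpan_insert_zero,
      hspan]
    rfl
  obtain ⟨f, hf⟩ := geometric_hahn_banach_open_point D.convex.interior isOpen_interior
    (fun h => hp (interior_subset h))
  have hle : ∀ y ∈ D, f y ≤ f p := by
    have hcl : (D : Set E) ⊆ closure (interior (D : Set E)) := by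
      rw [D.convex.closure_interior_eq_closure_of_nonempty_interior hint]
      exact subset_closure
    intro y hy
    have := closure_minimal (t := {y | f y ≤ f p}) (fun z hz => (hf z hz).le)
      (isClosed_le f.continuous continuous_const)
    exact this (hcl hy)
  have hnonpos : ∀ y ∈ D, f y ≤ 0 := by
    intro y hy
    by_contra! h
    obtain ⟨n, hn⟩ := exists_nat_gt (f p / f y)
    have := hle _ (D.smul_mem (Nat.cast_nonneg (α := ℝ) n) hy)
    rw [div_lt_iff₀ h] at hn
    simp at this
    linarith
  refine ⟨-(InnerProductSpace.toDual ℝ E).symm f, ?_, fun y hy => ?_⟩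
  · intro h
    obtain ⟨z, hz⟩ := hint
    have := hf z hz
    have hf0 : f = 0 := by simpa using h
    simp [hf0] at this
  · rw [inner_neg_left, InnerProductSpace.toDual_symm_apply]
    have := hnonpos y hy
    linarith

lemma InGeneralPosition.span_range_eq_top [FiniteDimensional ℝ E] {x : ι → E}
    (hx : InGeneralPosition x) (hcard : Module.finrank ℝ E ≤ Fintype.card ι) :
    Submodule.span ℝ (Set.range x) = ⊤ := by
  obtain ⟨T, -, hT⟩ := Finset.exists_subset_card_eq (s := Finset.univ) (by simpa using hcard)
  have hli := (hx T hT.le).linearIndependent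
  have htop : Submodule.span ℝ (Set.range fun a : (T : Set ι) => x a) = ⊤ :=
    hli.span_eq_top_of_card_eq_finrank' (by simp [hT])
  rw [eq_top_iff, ← htop]
  refine Submodule.span_mono ?_
  rintro _ ⟨a, rfl⟩
  exact ⟨a, rfl⟩

open scoped Pointwise in
/-- A proper face of a cone with generators in general position is exposed by a vector which is
positive on all generators off the face. -/
lemma PointedCone.IsFaceOf.separates [DecidableEq ι] [FiniteDimensional ℝ E] {x : ι → E}
    (hx : InGeneralPosition x) (hcard : Module.finrank ℝ E ≤ Fintype.card ι) {F : PointedCone ℝ E}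
    (hF : F.IsFaceOf (PointedCone.hull ℝ (Set.range x)))
    (hne : F ≠ PointedCone.hull ℝ (Set.range x)) {I : Finset ι} (hI : ∀ i, i ∈ I ↔ x i ∈ F) :
    Separates x I Iᶜ := by
  set C := PointedCone.hull ℝ (Set.range x) with hC
  have hspan : Submodule.span ℝ ((C ⊔ -F : PointedCone ℝ E) : Set E) = ⊤ := by
    rw [eq_top_iff, ← hx.span_range_eq_top hcard, Submodule.span_le]
    rintro _ ⟨i, rfl⟩
    exact Submodule.subset_span (Submodule.mem_sup_left
      (PointedCone.subset_hull (Set.mem_range_self i)))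
  have hD : C ⊔ -F ≠ ⊤ := by
    intro h
    refine hne (le_antisymm hF.le fun g hg => ?_)
    have hmem : -g ∈ C ⊔ -F := h ▸ Submodule.mem_top
    obtain ⟨c, hc, f, hf, hcf⟩ := Submodule.mem_sup.1 hmem
    refine hF.mem_of_add_mem_right hc hg ?_
    have : c + g = -f := by
      rw [← neg_eq_iff_eq_neg, neg_add, ← hcf]; abel
    rw [this]
    exact hf
  obtain ⟨u, hu0, hu⟩ := exists_inner_nonneg hspan hD
  refine separates_of_nonneg hx hu0 (fun i hi => ?_) fun i =>
    hu _ (Submodule.mem_sup_left (PointedCone.subset_hull (Set.mem_range_self i)))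
  have h1 := hu _ (Submodule.mem_sup_left (PointedCone.subset_hull (Set.mem_range_self i)))
  have h2 := hu (-x i) (Submodule.mem_sup_right (by simpa using (hI i).1 hi))
  rw [inner_neg_right] at h2
  linarith

lemma hull_range_ne_top_iff_separates [DecidableEq ι] [FiniteDimensional ℝ E] {x : ι → E}
    (hx : InGeneralPosition x) (hcard : Module.finrank ℝ E ≤ Fintype.card ι) [Nonempty ι] :
    PointedCone.hull ℝ (Set.range x) ≠ ⊤ ↔ Separates x ∅ Finset.univ := by
  constructor
  · intro h
    have hspan : Submodule.span ℝ (PointedCone.hull ℝ (Set.range x) : Set E) = ⊤ := by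
      rw [PointedCone.span_hull, hx.span_range_eq_top hcard]
    obtain ⟨u, hu0, hu⟩ := PointedCone.exists_inner_nonneg hspan h
    simpa using separates_of_nonneg (A := ∅) hx hu0 (by simp) fun i =>
      hu _ (PointedCone.subset_hull (Set.mem_range_self i))
  · rintro ⟨u, -, hu⟩ h
    have h1 := hu (Classical.arbitrary ι) (Finset.mem_univ _)
    have h2 := PointedCone.inner_nonneg_of_mem_hull_range
      (fun i => (hu i (Finset.mem_univ i)).le) (y := -x (Classical.arbitrary ι))
      (h ▸ Submodule.mem_top)
    rw [inner_neg_right] at h2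
    linarith

open Classical in
lemma faceNumber_eq_card [DecidableEq ι] {d k : ℕ} (hkd : k < d) {x : ι → EuclideanSpace ℝ (Fin d)}
    (hx : InGeneralPosition x) (hcard : d ≤ Fintype.card ι) :
    faceNumber k (PointedCone.hull ℝ (Set.range x)) =
      ((Finset.univ.powersetCard k).filter fun I => Separates x I Iᶜ).card := by
  have hfr : Module.finrank ℝ (EuclideanSpace ℝ (Fin d)) = d := finrank_euclideanSpace_fin
  have himage : coneFaces k (PointedCone.hull ℝ (Set.range x)) =
      (fun I : Finset ι => PointedCone.hull ℝ (x '' I)) ''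
        ((Finset.univ.powersetCard k).filter fun I => Separates x I Iᶜ : Finset (Finset ι)) := by
    ext F
    simp only [coneFaces, Set.mem_ofPred_eq, Set.mem_image, Finset.coe_filter,
      Finset.mem_powersetCard_univ]
    constructor
    · rintro ⟨hF, hdim⟩
      set I : Finset ι := Finset.univ.filter fun i => x i ∈ F with hIdef
      have hI : ∀ i, i ∈ I ↔ x i ∈ F := by simp [hIdef]
      have hFI := hF.eq_hull_image hI
      have hne : F ≠ PointedCone.hull ℝ (Set.range x) := by
        intro h
        rw [h, PointedCone.span_hull, hx.span_range_eq_top (hfr.trans_le hcard), finrank_top,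
          hfr] at hdim
        omega
      have hdimI : Module.finrank ℝ (Submodule.span ℝ (x '' I)) = k := by
        rw [← hdim, ← PointedCone.span_hull, ← hFI]
      refine ⟨I, ⟨?_, hF.separates hx (hfr.trans_le hcard) hne hI⟩, hFI.symm⟩
      rcases le_or_gt I.card d with h | h
      · rw [← hdimI, (hx I (by rwa [hfr])).finrank_span_image]
      · exfalso
        obtain ⟨T, hTI, hT⟩ := Finset.exists_subset_card_eq h.le
        have h1 := (hx T (by rw [hT, hfr])).finrank_span_image
        have h2 := Submodule.finrank_mono (Submodule.span_mono (R := ℝ)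
          (Set.image_mono (f := x) (Finset.coe_subset.2 hTI)))
        omega
    · rintro ⟨I, ⟨hk, u, hu, hu'⟩, rfl⟩
      refine ⟨PointedCone.isFaceOf_hull_image hu fun i hi => hu' i (by simpa using hi), ?_⟩
      rw [PointedCone.span_hull, (hx I (by rw [hk, hfr]; omega)).finrank_span_image, hk]
  have hinj : Set.InjOn (fun I : Finset ι => PointedCone.hull ℝ (x '' I))
      ((Finset.univ.powersetCard k).filter fun I => Separates x I Iᶜ : Finset (Finset ι)) := by
    have key : ∀ I J : Finset ι, Separates x J Jᶜ →
        PointedCone.hull ℝ (x '' I) = PointedCone.hull ℝ (x '' J) → I ⊆ J := by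
      rintro I J ⟨u, hu, hu'⟩ h i hi
      by_contra hiJ
      have hmem : x i ∈ PointedCone.hull ℝ (x '' J) :=
        h ▸ PointedCone.subset_hull (Set.mem_image_of_mem x hi)
      have hz : x i ∈ Submodule.span ℝ (x '' J) := PointedCone.hull_le_span _ _ hmem
      have hle : Submodule.span ℝ (x '' J) ≤ LinearMap.ker (innerₛₗ ℝ u) := by
        rw [Submodule.span_le]
        rintro _ ⟨a, ha, rfl⟩
        simpa using hu a ha
      have h1 := hle hz
      have h2 := hu' i (by simpa using hiJ)
      simp only [LinearMap.mem_ker, innerₛₗ_apply_apply] at h1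
      linarith
    intro I hI J hJ h
    simp only [Finset.coe_filter, Set.mem_ofPred_eq] at hI hJ
    exact Finset.Subset.antisymm (key I J hJ.2 h) (key J I hI.2 h.symm)
  rw [faceNumber, himage, hinj.ncard_image, Set.ncard_coe_finset]

end Cones

section Combinatorics

lemma coverCount_pos {n m : ℕ} (hm : 1 ≤ m) : 0 < coverCount n m := by
  induction n with
  | zero => simp [coverCount]
  | succ n ih =>
    obtain ⟨m, rfl⟩ := Nat.exists_eq_add_of_le' hm
    rw [coverCount]
    omega

/-- `coverCount (n + 1) m = 2 * ∑ i < m, n.choose i`. -/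
lemma coverCount_succ (n m : ℕ) :
    coverCount (n + 1) m = 2 * ∑ i ∈ Finset.range m, n.choose i := by
  induction n generalizing m with
  | zero =>
    cases m with
    | zero => simp [coverCount]
    | succ m => simp [coverCount, Finset.sum_range_succ']
  | succ n ih =>
    cases m with
    | zero => simp [coverCount]
    | succ m =>
      rw [coverCount, ih, ih, Finset.sum_range_succ', Finset.sum_range_succ' _ m]
      simp only [Nat.choose_succ_succ, Finset.sum_add_distrib, Nat.choose_zero_right]
      ring

lemma coverCount_succ_self (m : ℕ) : coverCount (m + 1) m = 2 * (2 ^ m - 1) := by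
  have h := Nat.sum_range_choose m
  rw [Finset.sum_range_succ, Nat.choose_self] at h
  rw [coverCount_succ]
  omega

/-- The quotient `(∑ i < m, n.choose i) / n.choose m` strictly decreases in `n`. -/
lemma choose_succ_mul_sum_lt {n m : ℕ} (hm : 1 ≤ m) (hmn : m ≤ n) :
    (∑ i ∈ Finset.range m, (n + 1).choose i) * n.choose m <
      (∑ i ∈ Finset.range m, n.choose i) * (n + 1).choose m := by
  rw [Finset.sum_mul, Finset.sum_mul]
  refine Finset.sum_lt_sum_of_nonempty (by simpa using by omega) fun i hi => ?_
  have hi : i < m := by simpa using hi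
  have h1 := Nat.choose_mul_succ_eq n i
  have h2 := Nat.choose_mul_succ_eq n m
  have hpi : 0 < (n + 1).choose i := Nat.choose_pos (by omega)
  have hpm : 0 < (n + 1).choose m := Nat.choose_pos (by omega)
  refine Nat.lt_of_mul_lt_mul_right (a := n + 1) ?_
  rw [mul_assoc, h2, mul_right_comm, h1]
  have : n + 1 - m < n + 1 - i := by omega
  have h3 := Nat.mul_lt_mul_of_pos_left this (Nat.mul_pos hpi hpm)
  linarith [h3, mul_comm ((n+1).choose i) ((n+1).choose m)]

/-- The quotient `coverCount n m / coverCount (n + 1) (m + 1)` strictly decreases in `n`. -/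
lemma coverCount_cross_lt {n m : ℕ} (hm : 1 ≤ m) (hmn : m ≤ n) :
    coverCount (n + 2) m * coverCount (n + 2) (m + 1) <
      coverCount (n + 1) m * coverCount (n + 3) (m + 1) := by
  have h := choose_succ_mul_sum_lt hm hmn
  have e1 : coverCount (n + 3) (m + 1) = coverCount (n + 2) (m + 1) + coverCount (n + 2) m := rfl
  have e2 : coverCount (n + 2) (m + 1) = coverCount (n + 1) (m + 1) + coverCount (n + 1) m := rfl
  have e3 : coverCount (n + 2) (m + 1) = coverCount (n + 2) m + 2 * (n + 1).choose m := by
    rw [coverCount_succ, coverCount_succ, Finset.sum_range_succ]; ring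
  have e4 : coverCount (n + 1) (m + 1) = coverCount (n + 1) m + 2 * n.choose m := by
    rw [coverCount_succ, coverCount_succ, Finset.sum_range_succ]; ring
  have e5 := coverCount_succ n m
  have e6 := coverCount_succ (n + 1) m
  have h' : coverCount (n + 2) m * n.choose m < coverCount (n + 1) m * (n + 1).choose m := by
    rw [e5, e6]; linarith
  rw [e1]
  nlinarith

/-- The expected proportion of `k`-subsets spanning a face. -/
noncomputable def faceRatio (d k N : ℕ) : ℝ :=
  2 ^ k * coverCount (N - k) (d - k) / coverCount N d

lemma faceRatio_succ_lt {d k N : ℕ} (hk : 1 ≤ k) (hkd : k < d) (hN : d < N) :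
    faceRatio d k (N + 1) < faceRatio d k N := by
  have key : ∀ j, 1 ≤ j → j ≤ k →
      coverCount (N + 1 - j) (d - j) * coverCount N d <
        coverCount (N - j) (d - j) * coverCount (N + 1) d := by
    intro j hj
    induction j, hj using Nat.le_induction with
    | base =>
      intro _
      obtain ⟨m, rfl⟩ : ∃ m, d = m + 1 := ⟨d - 1, by omega⟩
      obtain ⟨n, rfl⟩ : ∃ n, N = n + 2 := ⟨N - 2, by omega⟩
      exact coverCount_cross_lt (by omega) (by omega)
    | succ j hj ih =>
      intro hjk
      have h1 := ih (by omega)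
      obtain ⟨m, hm⟩ : ∃ m, d = m + 1 + j := ⟨d - 1 - j, by omega⟩
      obtain ⟨n, hn⟩ : ∃ n, N = n + 2 + j := ⟨N - 2 - j, by omega⟩
      have h2 := coverCount_cross_lt (n := n) (m := m) (by omega) (by omega)
      rw [show N + 1 - j = n + 3 by omega, show d - j = m + 1 by omega,
        show N - j = n + 2 by omega] at h1
      rw [show N + 1 - (j + 1) = n + 2 by omega, show d - (j + 1) = m by omega,
        show N - (j + 1) = n + 1 by omega]
      have hp : 0 < coverCount (n + 2) (m + 1) := coverCount_pos (by omega)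
      have hpN : 0 < coverCount N d := coverCount_pos (by omega)
      have hpm : 0 < coverCount (n + 1) m := coverCount_pos (by omega)
      refine Nat.lt_of_mul_lt_mul_right (a := coverCount (n + 2) (m + 1)) ?_
      calc coverCount (n + 2) m * coverCount N d * coverCount (n + 2) (m + 1)
          = coverCount (n + 2) m * coverCount (n + 2) (m + 1) * coverCount N d := by ring
        _ < coverCount (n + 1) m * coverCount (n + 3) (m + 1) * coverCount N d :=
          Nat.mul_lt_mul_of_pos_right h2 hpN
        _ = coverCount (n + 1) m * (coverCount (n + 3) (m + 1) * coverCount N d) := by ring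
        _ ≤ coverCount (n + 1) m * (coverCount (n + 2) (m + 1) * coverCount (N + 1) d) :=
          Nat.mul_le_mul_left _ h1.le
        _ = _ := by ring
  have h := key k hk le_rfl
  have p1 : (0 : ℝ) < coverCount N d := by exact_mod_cast coverCount_pos (by omega)
  have p2 : (0 : ℝ) < coverCount (N + 1) d := by exact_mod_cast coverCount_pos (by omega)
  unfold faceRatio
  rw [div_lt_div_iff₀ p2 p1, mul_assoc, mul_assoc]
  exact mul_lt_mul_of_pos_left (by exact_mod_cast h) (by positivity)

lemma faceRatio_succ_self {d k : ℕ} (hkd : k < d) :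
    faceRatio d k (d + 1) = ((2 : ℝ) ^ d - 2 ^ k) / ((2 : ℝ) ^ d - 1) := by
  have h2 : ∀ m : ℕ, (coverCount (m + 1) m : ℝ) = 2 * (2 ^ m - 1) := by
    intro m
    rw [coverCount_succ_self]
    push_cast [Nat.one_le_two_pow]
    rfl
  unfold faceRatio
  rw [show d + 1 - k = d - k + 1 by omega, h2, h2, mul_left_comm,
    mul_div_mul_left _ _ (two_ne_zero), mul_sub, ← pow_add, show k + (d - k) = d by omega, mul_one]

lemma faceRatio_strictAntiOn {d k : ℕ} (hk : 1 ≤ k) (hkd : k < d) :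
    StrictAntiOn (faceRatio d k) (Set.Ioi d) := by
  intro M hM N _ hMN
  induction N, hMN using Nat.le_induction with
  | base => exact faceRatio_succ_lt hk hkd hM
  | succ N h ih =>
    have hdN : d < N := lt_of_lt_of_le hM (by omega)
    exact (faceRatio_succ_lt hk hkd hdN).trans (ih hdN)

end Combinatorics

lemma faceNumber_top {d k : ℕ} (hkd : k < d) :
    faceNumber k (⊤ : PointedCone ℝ (EuclideanSpace ℝ (Fin d))) = 0 := by
  have h : coneFaces k (⊤ : PointedCone ℝ (EuclideanSpace ℝ (Fin d))) = ∅ := by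
    refine Set.eq_empty_of_forall_notMem fun F ⟨hF, hdim⟩ => ?_
    have hF' : F = ⊤ := top_unique fun y _ =>
      hF.mem_of_add_mem_left (y := -y) Submodule.mem_top Submodule.mem_top
        (by rw [add_neg_cancel]; exact F.zero_mem)
    rw [hF', Submodule.top_coe, Submodule.span_univ, finrank_top, finrank_euclideanSpace_fin] at hdim
    omega
  rw [faceNumber, h, Set.ncard_empty]

section CoverEfron

variable {d k : ℕ} {φ : Measure (EuclideanSpace ℝ (Fin d))} [IsProbabilityMeasure φ]
  {Ω : Type*} [MeasurableSpace Ω] {P : Measure Ω}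
  {X : ℕ → Ω → EuclideanSpace ℝ (Fin d)}

omit [IsProbabilityMeasure φ] in
lemma measurePreserving_initial [IsProbabilityMeasure P]
    (hX_meas : ∀ i, Measurable (X i)) (hX_law : ∀ i, P.map (X i) = φ)
    (hX_indep : iIndepFun X P) (N : ℕ) :
    MeasurePreserving (fun ω (i : Fin N) => X i ω) P (Measure.pi fun _ => φ) := by
  refine ⟨measurable_pi_lambda _ fun i => hX_meas i, ?_⟩
  have h : iIndepFun (fun i : Fin N => X i) P := hX_indep.precomp Fin.val_injective
  rw [h.map_fun_eq_pi_map fun i : Fin N => (hX_meas i).aemeasurable]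
  simp [hX_law]

variable {N : ℕ}

lemma ae_posHull_ne_top_iff (hN : d < N)
    (hφ : ∀ u : EuclideanSpace ℝ (Fin d), u ≠ 0 → φ {x | inner ℝ u x = 0} = 0)
    (hX : MeasurePreserving (fun ω (i : Fin N) => X i ω) P (Measure.pi fun _ => φ)) :
    ∀ᵐ ω ∂P, posHull (fun i => X i ω) N ≠ ⊤ ↔
      Separates (fun i : Fin N => X i ω) ∅ Finset.univ := by
  have : Nonempty (Fin N) := ⟨⟨0, by omega⟩⟩
  filter_upwards [hX.quasiMeasurePreserving.ae (ae_inGeneralPosition hφ)] with ω hω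
  exact hull_range_ne_top_iff_separates hω (by simpa using hN.le)

/-- **Wendel's theorem**: the probability that the positive hull is not the whole space. -/
lemma measureReal_posHull_ne_top (hN : d < N) (hφ_even : φ.map (fun x => -x) = φ)
    (hφ : ∀ u : EuclideanSpace ℝ (Fin d), u ≠ 0 → φ {x | inner ℝ u x = 0} = 0)
    (hX : MeasurePreserving (fun ω (i : Fin N) => X i ω) P (Measure.pi fun _ => φ)) :
    P.real {ω | posHull (fun i => X i ω) N ≠ ⊤} = coverCount N d / 2 ^ N := by
  have h1 : P.real {ω | posHull (fun i => X i ω) N ≠ ⊤} =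
      P.real ((fun ω (i : Fin N) => X i ω) ⁻¹' {x | Separates x ∅ Finset.univ}) := by
    refine measureReal_congr ?_
    filter_upwards [ae_posHull_ne_top_iff hN hφ hX] with ω hω
    exact propext hω
  rw [h1, hX.measureReal_preimage (measurableSet_separates _ _).nullMeasurableSet,
    measure_separates hφ_even hφ _ _ (Finset.disjoint_empty_left _) (by simp)]
  simp

open Classical in
lemma ae_faceNumber_eq_sum (hkd : k < d) (hN : d < N)
    (hφ : ∀ u : EuclideanSpace ℝ (Fin d), u ≠ 0 → φ {x | inner ℝ u x = 0} = 0)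
    (hX : MeasurePreserving (fun ω (i : Fin N) => X i ω) P (Measure.pi fun _ => φ)) :
    ∀ᵐ ω ∂P, (faceNumber k (posHull (fun i => X i ω) N) : ℝ) =
      ∑ I ∈ Finset.univ.powersetCard k,
        ((fun ω (i : Fin N) => X i ω) ⁻¹' {x | Separates x I Iᶜ}).indicator (fun _ => (1 : ℝ)) ω := by
  filter_upwards [hX.quasiMeasurePreserving.ae (ae_inGeneralPosition hφ)] with ω hω
  rw [posHull, faceNumber_eq_card hkd hω (by simpa using hN.le), Finset.card_filter]
  push_cast
  exact Finset.sum_congr rfl fun I _ => by simp [Set.indicator]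

lemma integrable_faceNumber [IsProbabilityMeasure P] (hkd : k < d) (hN : d < N)
    (hφ : ∀ u : EuclideanSpace ℝ (Fin d), u ≠ 0 → φ {x | inner ℝ u x = 0} = 0)
    (hX : MeasurePreserving (fun ω (i : Fin N) => X i ω) P (Measure.pi fun _ => φ)) :
    Integrable (fun ω => (faceNumber k (posHull (fun i => X i ω) N) : ℝ)) P := by
  classical
  refine Integrable.congr (integrable_finsetSum _ fun I _ => ?_)
    (ae_eq_symm (ae_faceNumber_eq_sum hkd hN hφ hX))
  exact (integrable_const 1).indicator (hX.measurable (measurableSet_separates I Iᶜ))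

lemma integral_faceNumber [IsProbabilityMeasure P] (hkd : k < d) (hN : d < N)
    (hφ_even : φ.map (fun x => -x) = φ)
    (hφ : ∀ u : EuclideanSpace ℝ (Fin d), u ≠ 0 → φ {x | inner ℝ u x = 0} = 0)
    (hX : MeasurePreserving (fun ω (i : Fin N) => X i ω) P (Measure.pi fun _ => φ)) :
    ∫ ω, (faceNumber k (posHull (fun i => X i ω) N) : ℝ) ∂P =
      N.choose k * (coverCount (N - k) (d - k) / 2 ^ (N - k)) := by
  classical
  rw [integral_congr_ae (ae_faceNumber_eq_sum hkd hN hφ hX), integral_finsetSum]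
  · have : ∀ I ∈ (Finset.univ : Finset (Fin N)).powersetCard k,
        ∫ ω, ((fun ω (i : Fin N) => X i ω) ⁻¹' {x | Separates x I Iᶜ}).indicator
          (fun _ => (1 : ℝ)) ω ∂P = coverCount (N - k) (d - k) / 2 ^ (N - k) := by
      intro I hI
      rw [Finset.mem_powersetCard_univ] at hI
      rw [integral_indicator_const _ (hX.measurable (measurableSet_separates I Iᶜ)),
        hX.measureReal_preimage (measurableSet_separates _ _).nullMeasurableSet,
        measure_separates hφ_even hφ _ _ disjoint_compl_right
          (by rw [finrank_euclideanSpace_fin]; omega)]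
      simp [Finset.card_compl, hI]
    rw [Finset.sum_congr rfl this]
    simp
  · exact fun I _ => (integrable_const 1).indicator (hX.measurable (measurableSet_separates I Iᶜ))

/-- The expected face numbers of the Cover-Efron cone. -/
lemma expectedFaceNumber_div_choose [IsProbabilityMeasure P] (hkd : k < d) (hN : d < N)
    (hφ_even : φ.map (fun x => -x) = φ)
    (hφ : ∀ u : EuclideanSpace ℝ (Fin d), u ≠ 0 → φ {x | inner ℝ u x = 0} = 0)
    (hX : MeasurePreserving (fun ω (i : Fin N) => X i ω) P (Measure.pi fun _ => φ)) :
    expectedFaceNumber P X k N / (N.choose k : ℝ) = faceRatio d k N := by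
  have hzero : ∀ ω, ω ∉ {ω | posHull (fun i => X i ω) N ≠ ⊤} →
      (faceNumber k (posHull (fun i => X i ω) N) : ℝ) = 0 := by
    intro ω hω
    have : posHull (fun i => X i ω) N = ⊤ := by simpa using hω
    rw [this, faceNumber_top hkd, Nat.cast_zero]
  have hc : (N.choose k : ℝ) ≠ 0 := by exact_mod_cast (Nat.choose_pos (by omega)).ne'
  rw [expectedFaceNumber, coverEfronMeasure, ProbabilityTheory.cond, integral_smul_measure,
    setIntegral_eq_integral_of_forall_compl_eq_zero hzero, integral_faceNumber hkd hN hφ_even hφ hX,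
    ENNReal.toReal_inv, ← Measure.real, measureReal_posHull_ne_top hN hφ_even hφ hX, faceRatio,
    smul_eq_mul, show (2 : ℝ) ^ N = 2 ^ k * 2 ^ (N - k) by rw [← pow_add]; congr 1; omega]
  field_simp

end CoverEfron

theorem mainTheorem2 {d k : ℕ} (hk : 1 ≤ k) (hkd : k < d)
    (φ : Measure (EuclideanSpace ℝ (Fin d))) [IsProbabilityMeasure φ]
    (hφ_even : φ.map (fun x => -x) = φ)
    (hφ_hyperplane : ∀ u : EuclideanSpace ℝ (Fin d), u ≠ 0 → φ {x | inner ℝ u x = 0} = 0)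
    {Ω : Type*} [MeasurableSpace Ω] (P : Measure Ω) [IsProbabilityMeasure P]
    (X : ℕ → Ω → EuclideanSpace ℝ (Fin d))
    (hX_meas : ∀ i, Measurable (X i)) (hX_law : ∀ i, P.map (X i) = φ)
    (hX_indep : iIndepFun X P) :
    (∀ N : ℕ, d < N →
      Integrable (fun ω => (faceNumber k (posHull (fun i => X i ω) N) : ℝ))
        (coverEfronMeasure P X N)) ∧
    (∀ N : ℕ, d < N →
      expectedFaceNumber P X k (N + 1) / ((N + 1).choose k : ℝ) <
        expectedFaceNumber P X k N / (N.choose k : ℝ)) ∧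
    StrictAntiOn (fun N : ℕ => expectedFaceNumber P X k N / (N.choose k : ℝ)) (Set.Ioi d) ∧
    (∀ N : ℕ, d < N →
      expectedFaceNumber P X k N / (N.choose k : ℝ) ≤
        ((2 : ℝ) ^ d - 2 ^ k) / ((2 : ℝ) ^ d - 1)) ∧
    (∀ N : ℕ, d < N →
      (expectedFaceNumber P X k N / (N.choose k : ℝ) =
        ((2 : ℝ) ^ d - 2 ^ k) / ((2 : ℝ) ^ d - 1) ↔ N = d + 1)) := by
  have hX := measurePreserving_initial hX_meas hX_law hX_indep
  have hratio : ∀ N : ℕ, d < N →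
      expectedFaceNumber P X k N / (N.choose k : ℝ) = faceRatio d k N := fun N hN =>
    expectedFaceNumber_div_choose hkd hN hφ_even hφ_hyperplane (hX N)
  have hanti := faceRatio_strictAntiOn hk hkd
  have hbase : d + 1 ∈ Set.Ioi d := Nat.lt_succ_self d
  refine ⟨fun N hN => ?_, fun N hN => ?_, fun M hM N hN hMN => ?_, fun N hN => ?_, fun N hN => ?_⟩
  · refine ((integrable_faceNumber hkd hN hφ_hyperplane (hX N)).restrict).smul_measure ?_
    rw [ENNReal.inv_ne_top]
    intro h0
    have h1 := measureReal_posHull_ne_top hN hφ_even hφ_hyperplane (hX N)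
    have h2 : (0 : ℝ) < coverCount N d := by exact_mod_cast coverCount_pos (by omega)
    rw [Measure.real, h0, ENNReal.toReal_zero] at h1
    have h3 : (0 : ℝ) < coverCount N d / 2 ^ N := by positivity
    exact h3.ne h1
  · rw [hratio N hN, hratio (N + 1) (by omega)]
    exact faceRatio_succ_lt hk hkd hN
  · simp only
    rw [hratio M hM, hratio N hN]
    exact hanti hM hN hMN
  · rw [hratio N hN, ← faceRatio_succ_self hkd]
    exact hanti.antitoneOn hbase hN hN
  · rw [hratio N hN, ← faceRatio_succ_self hkd]
    exact ⟨fun h => hanti.injOn hN hbase h, fun h => h ▸ rfl⟩
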